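/- Proposition 5.1. Let $X$ be a real Banach space with dual $X^*$, and let $B_{X^*}$ and $S_{X^*}$ be the closed unit ball and the unit sphere of $X^*$. A point $x^*\in B_{X^*}$ is called a Namioka point of $B_{X^*}$ if the identity map from $(B_{X^*},\text{weak}^*)$ to $(B_{X^*},\text{weak})$ is continuous at $x^*$, where the weak topology on $X^*$ is the one induced by $X^{**}$. The space $X$ has Property (N) if the Namioka points of $B_{X^*}$ are weakly dense in $S_{X^*}$, that is, if $S_{X^*}$ is contained in the weak closure of the set of Namioka points of $B_{X^*}$. Property (N) is not inherited by closed subspaces: there exist a real Banach space $X$ with Property (N) and a closed linear subspace $Y\subset X$, with the norm of $X$, such that $Y$ does not have Property (N). -/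

import Mathlib

/-- `f` is a Namioka point of the closed unit ball `B` of the dual `X*` of a real normed space `X`:
`f` lies in `B`, and the identity map from `B` with the weak-star topology to `B` with the weak
topology (the one induced by the bidual of `X`) is continuous at `f`. -/
def IsNamiokaPoint {X : Type*} [NormedAddCommGroup X] [NormedSpace ℝ X]
    (f : StrongDual ℝ X) : Prop :=
  f ∈ Metric.closedBall (0 : StrongDual ℝ X) 1 ∧
    ContinuousWithinAt
      (fun g : WeakDual ℝ X => toWeakSpace ℝ (StrongDual ℝ X) (WeakDual.toStrongDual g))
      (WeakDual.toStrongDual ⁻¹' Metric.closedBall (0 : StrongDual ℝ X) 1)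
      (StrongDual.toWeakDual f)

/-- Property (N): the Namioka points of the dual unit ball are dense in the dual unit sphere for the
weak topology of the dual. -/
def PropertyN (X : Type*) [NormedAddCommGroup X] [NormedSpace ℝ X] : Prop :=
  toWeakSpace ℝ (StrongDual ℝ X) '' Metric.sphere (0 : StrongDual ℝ X) 1 ⊆
    closure (toWeakSpace ℝ (StrongDual ℝ X) '' {f : StrongDual ℝ X | IsNamiokaPoint f})

open Filter Topology
open scoped ZeroAtInfty

section WeakTopology

variable {X : Type*} [NormedAddCommGroup X] [NormedSpace ℝ X]

theorem tendsto_toWeakSpace_iff {ι : Type*} {l : Filter ι} {u : ι → X} {x : X} :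
    Tendsto (fun i => toWeakSpace ℝ X (u i)) l (𝓝 (toWeakSpace ℝ X x)) ↔
      ∀ φ : StrongDual ℝ X, Tendsto (fun i => φ (u i)) l (𝓝 (φ x)) := by
  refine WeakBilin.tendsto_iff_forall_eval_tendsto (topDualPairing ℝ X).flip ?_
  intro a b hab
  refine (SeparatingDual.eq_iff_forall_dual_eq (R := ℝ)).2 fun g => ?_
  exact congrArg (fun h => h g) hab

theorem tendsto_toWeakDual_iff {ι : Type*} {l : Filter ι} {u : ι → StrongDual ℝ X}
    {f : StrongDual ℝ X} :
    Tendsto (fun i => StrongDual.toWeakDual (u i)) l (𝓝 (StrongDual.toWeakDual f)) ↔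
      ∀ x : X, Tendsto (fun i => u i x) l (𝓝 (f x)) :=
  tendsto_iff_forall_eval_tendsto_topDualPairing

/-- Namioka points are characterised by filters: weak-star convergence to the point inside the ball
implies weak convergence. -/
theorem IsNamiokaPoint.tendsto {f : StrongDual ℝ X} (hf : IsNamiokaPoint f) {ι : Type*}
    {l : Filter ι} {u : ι → StrongDual ℝ X} (hu : ∀ i, ‖u i‖ ≤ 1)
    (hlim : ∀ x, Tendsto (fun i => u i x) l (𝓝 (f x))) (φ : StrongDual ℝ (StrongDual ℝ X)) :
    Tendsto (fun i => φ (u i)) l (𝓝 (φ f)) := by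
  have h1 : Tendsto (fun i => StrongDual.toWeakDual (u i)) l
      (𝓝[WeakDual.toStrongDual ⁻¹' Metric.closedBall (0 : StrongDual ℝ X) 1]
        (StrongDual.toWeakDual f)) := by
    refine tendsto_nhdsWithin_iff.2 ⟨tendsto_toWeakDual_iff.2 hlim, Eventually.of_forall fun i => ?_⟩
    simpa using hu i
  exact tendsto_toWeakSpace_iff.1 (hf.2.tendsto.comp h1) φ

theorem isNamiokaPoint_of_tendsto {f : StrongDual ℝ X} (hf : ‖f‖ ≤ 1)
    (h : ∀ l : Filter (StrongDual ℝ X), (∀ᶠ g in l, ‖g‖ ≤ 1) →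
      (∀ x, Tendsto (fun g : StrongDual ℝ X => g x) l (𝓝 (f x))) →
      ∀ φ : StrongDual ℝ (StrongDual ℝ X), Tendsto φ l (𝓝 (φ f))) :
    IsNamiokaPoint f := by
  refine ⟨by simpa using hf, ?_⟩
  set s : Set (WeakDual ℝ X) := WeakDual.toStrongDual ⁻¹' Metric.closedBall (0 : StrongDual ℝ X) 1
  refine tendsto_toWeakSpace_iff.2 fun φ => ?_
  have h2 := h (map WeakDual.toStrongDual (𝓝[s] (StrongDual.toWeakDual f))) ?_ ?_ φ
  · exact tendsto_map'_iff.1 h2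
  · rw [eventually_map]
    filter_upwards [self_mem_nhdsWithin] with g hg
    simpa [s] using hg
  · intro x
    rw [tendsto_map'_iff]
    exact ((WeakDual.eval_continuous x).tendsto _).mono_left nhdsWithin_le_nhds

theorem closure_toWeakSpace_subset_ker {s : Set X} (φ : StrongDual ℝ X) (hs : ∀ x ∈ s, φ x = 0)
    {x : X} (hx : toWeakSpace ℝ X x ∈ closure (toWeakSpace ℝ X '' s)) : φ x = 0 := by
  have hc : IsClosed {y : WeakSpace ℝ X | φ ((toWeakSpace ℝ X).symm y) = 0} :=
    isClosed_eq (WeakBilin.eval_continuous (topDualPairing ℝ X).flip φ) continuous_const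
  refine closure_minimal (t := {y : WeakSpace ℝ X | φ ((toWeakSpace ℝ X).symm y) = 0}) ?_ hc hx
  rintro _ ⟨y, hy, rfl⟩
  exact hs y hy

/-- The dual norm is weak-star lower semicontinuous. -/
theorem eventually_lt_norm_of_tendsto_apply {ι : Type*} {l : Filter ι} {u : ι → StrongDual ℝ X}
    {f : StrongDual ℝ X} (h : ∀ x, Tendsto (fun i => u i x) l (𝓝 (f x))) {r : ℝ} (hr : r < ‖f‖) :
    ∀ᶠ i in l, r < ‖u i‖ := by
  obtain ⟨x, hx, hrx⟩ := f.exists_lt_apply_of_lt_opNorm hr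
  filter_upwards [(h x).norm.eventually_const_lt hrx] with i hi
  exact hi.trans_le ((u i).unit_le_opNorm x hx.le)

theorem norm_comp_inl_add_norm_comp_inr_le {A B : Type*} [NormedAddCommGroup A] [NormedSpace ℝ A]
    [NormedAddCommGroup B] [NormedSpace ℝ B] (F : StrongDual ℝ (A × B)) :
    ‖F.comp (ContinuousLinearMap.inl ℝ A B)‖ + ‖F.comp (ContinuousLinearMap.inr ℝ A B)‖ ≤ ‖F‖ := by
  refine le_of_forall_lt fun c hc => ?_
  obtain ⟨r, s, hr, hs, rfl⟩ : ∃ r s, r < ‖F.comp (ContinuousLinearMap.inl ℝ A B)‖ ∧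
      s < ‖F.comp (ContinuousLinearMap.inr ℝ A B)‖ ∧ r + s = c := by
    set p := ‖F.comp (ContinuousLinearMap.inl ℝ A B)‖
    set q := ‖F.comp (ContinuousLinearMap.inr ℝ A B)‖
    exact ⟨p - (p + q - c) / 2, q - (p + q - c) / 2, by linarith, by linarith, by ring⟩
  obtain ⟨x, hx, hrx⟩ := (F.comp (ContinuousLinearMap.inl ℝ A B)).exists_lt_apply_of_lt_opNorm hr
  obtain ⟨y, hy, hsy⟩ := (F.comp (ContinuousLinearMap.inr ℝ A B)).exists_lt_apply_of_lt_opNorm hs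
  obtain ⟨x', hx', hrx'⟩ : ∃ x', ‖x'‖ < 1 ∧ r < F (x', 0) := by
    rcases lt_abs.1 hrx with h | h
    · exact ⟨x, hx, h⟩
    · refine ⟨-x, by simpa using hx, ?_⟩
      have : F (-x, 0) = - F (x, 0) := by rw [← map_neg]; simp
      simpa [this] using h
  obtain ⟨y', hy', hsy'⟩ : ∃ y', ‖y'‖ < 1 ∧ s < F (0, y') := by
    rcases lt_abs.1 hsy with h | h
    · exact ⟨y, hy, h⟩
    · refine ⟨-y, by simpa using hy, ?_⟩
      have : F (0, -y) = - F (0, y) := by rw [← map_neg]; simp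
      simpa [this] using h
  have h1 : F (x', y') = F (x', 0) + F (0, y') := by rw [← map_add]; simp
  have h2 : ‖F (x', y')‖ ≤ ‖F‖ :=
    F.unit_le_opNorm _ (by rw [Prod.norm_def]; exact max_le hx'.le hy'.le)
  have := (le_abs_self _).trans h2
  linarith

end WeakTopology

section NullSequences

/-- The unit vectors of `c₀`. -/
def ZeroAtInftyContinuousMap.basisVec (k : ℕ) : C₀(ℕ, ℝ) where
  toFun := (Pi.single k 1 : ℕ → ℝ)
  continuous_toFun := continuous_of_discreteTopology
  zero_at_infty' := by
    rw [cocompact_eq_cofinite]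
    refine tendsto_const_nhds.congr' ?_
    filter_upwards [(Set.finite_singleton k).compl_mem_cofinite] with n hn
    exact (Pi.single_eq_of_ne (M := fun _ => ℝ) hn _).symm

namespace ZeroAtInftyContinuousMap

theorem basisVec_apply (k n : ℕ) : basisVec k n = if n = k then 1 else 0 := by
  change (Pi.single k 1 : ℕ → ℝ) n = _
  simp [Pi.single_apply]

/-- The finitely supported sequence that agrees with `y` below `m`. -/
noncomputable def truncation (m : ℕ) (y : ℕ → ℝ) : C₀(ℕ, ℝ) := ∑ k ∈ Finset.range m, y k • basisVec k

theorem truncation_apply (m : ℕ) (y : ℕ → ℝ) (n : ℕ) :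
    truncation m y n = if n < m then y n else 0 := by
  have h : ∀ s : Finset ℕ, (∑ k ∈ s, y k • basisVec k : C₀(ℕ, ℝ)) n
      = ∑ k ∈ s, y k * basisVec k n := by
    intro s
    induction s using Finset.induction_on with
    | empty => simp
    | insert a s ha ih => simp [Finset.sum_insert ha, ih]
  rw [truncation, h]
  simp [basisVec_apply]

theorem abs_apply_le_norm (x : C₀(ℕ, ℝ)) (n : ℕ) : |x n| ≤ ‖x‖ :=
  x.toBCF.norm_coe_le_norm n

theorem norm_le_of_forall_abs_le {x : C₀(ℕ, ℝ)} {C : ℝ} (hC : 0 ≤ C) (h : ∀ n, |x n| ≤ C) :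
    ‖x‖ ≤ C :=
  (BoundedContinuousFunction.norm_le hC).2 h

theorem tendsto_apply_atTop (x : C₀(ℕ, ℝ)) : Tendsto x atTop (𝓝 0) := by
  have := x.zero_at_infty'
  rwa [cocompact_eq_cofinite, Nat.cofinite_eq_atTop] at this

theorem tendsto_truncation (x : C₀(ℕ, ℝ)) : Tendsto (fun m => truncation m x) atTop (𝓝 x) := by
  refine Metric.tendsto_atTop.2 fun ε hε => ?_
  obtain ⟨M, hM⟩ := Metric.tendsto_atTop.1 x.tendsto_apply_atTop (ε / 2) (half_pos hε)
  refine ⟨M, fun m hm => ?_⟩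
  rw [dist_eq_norm]
  refine (norm_le_of_forall_abs_le (half_pos hε).le fun n => ?_).trans_lt (half_lt_self hε)
  rw [sub_apply, truncation_apply]
  split_ifs with hn
  · simpa using (half_pos hε).le
  · have := hM n (by omega)
    rw [Real.dist_0_eq_abs] at this
    simpa using this.le

/-- The projection of `c₀` onto its first `m` coordinates. -/
noncomputable def truncationL (m : ℕ) : C₀(ℕ, ℝ) →L[ℝ] C₀(ℕ, ℝ) :=
  LinearMap.mkContinuous
    { toFun := fun x => truncation m x
      map_add' := fun x y => by
        ext n
        simp only [truncation_apply, add_apply]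
        split_ifs <;> simp
      map_smul' := fun c x => by simp [truncation, mul_smul, Finset.smul_sum] } 1
    fun x => by
      rw [one_mul]
      refine norm_le_of_forall_abs_le (norm_nonneg _) fun n => ?_
      change |truncation m x n| ≤ _
      rw [truncation_apply]
      split_ifs
      · exact x.abs_apply_le_norm n
      · simp

theorem truncationL_apply (m : ℕ) (x : C₀(ℕ, ℝ)) : truncationL m x = truncation m x := rfl

/-- The coordinate projections of `c₀` are `L`-projections on the dual. -/
theorem norm_comp_truncationL_add_le (m : ℕ) (f : StrongDual ℝ C₀(ℕ, ℝ)) :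
    ‖f.comp (truncationL m)‖ + ‖f.comp (ContinuousLinearMap.id ℝ _ - truncationL m)‖ ≤ ‖f‖ := by
  set S : C₀(ℕ, ℝ) × C₀(ℕ, ℝ) →L[ℝ] C₀(ℕ, ℝ) :=
    (truncationL m).coprod (ContinuousLinearMap.id ℝ _ - truncationL m)
  have hS : ‖S‖ ≤ 1 := by
    refine S.opNorm_le_bound zero_le_one fun ⟨x, y⟩ => ?_
    rw [one_mul]
    refine norm_le_of_forall_abs_le (norm_nonneg _) fun n => ?_
    have h : S (x, y) n = if n < m then x n else y n := by
      simp only [S, ContinuousLinearMap.coprod_apply, truncationL_apply, add_apply,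
        _root_.sub_apply, ContinuousLinearMap.id_apply, sub_apply, truncation_apply]
      split_ifs <;> simp
    rw [h]
    split_ifs
    · exact (x.abs_apply_le_norm n).trans (norm_fst_le (x, y))
    · exact (y.abs_apply_le_norm n).trans (norm_snd_le (x, y))
  have h := norm_comp_inl_add_norm_comp_inr_le (f.comp S)
  rw [ContinuousLinearMap.comp_assoc, ContinuousLinearMap.comp_assoc,
    ContinuousLinearMap.coprod_comp_inl, ContinuousLinearMap.coprod_comp_inr] at h
  refine h.trans ((f.opNorm_comp_le S).trans ?_)
  exact mul_le_of_le_one_right (norm_nonneg _) hS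

/-- The dual norm of `c₀` has the weak-star Kadec property. -/
theorem tendsto_dual_of_tendsto_apply {ι : Type*} {l : Filter ι}
    {b : ι → StrongDual ℝ C₀(ℕ, ℝ)} {a : StrongDual ℝ C₀(ℕ, ℝ)}
    (hlim : ∀ x, Tendsto (fun i => b i x) l (𝓝 (a x)))
    (hnorm : ∀ ε > 0, ∀ᶠ i in l, ‖b i‖ ≤ ‖a‖ + ε) : Tendsto b l (𝓝 a) := by
  refine (Metric.nhds_basis_ball (x := a)).tendsto_right_iff.2 fun δ hδ => ?_
  set ε := δ / 6 with hε_def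
  have hε : 0 < ε := by positivity
  obtain ⟨m, hm⟩ : ∃ m, ‖a‖ - ε < ‖a.comp (truncationL m)‖ :=
    (eventually_lt_norm_of_tendsto_apply (l := atTop) (u := fun m => a.comp (truncationL m))
      (fun x => (a.continuous.tendsto x).comp x.tendsto_truncation)
      (sub_lt_self ‖a‖ hε)).exists
  have hsum : ∀ᶠ i in l, ∑ k ∈ Finset.range m, |b i (basisVec k) - a (basisVec k)| < ε := by
    have : Tendsto (fun i => ∑ k ∈ Finset.range m, |b i (basisVec k) - a (basisVec k)|) l (𝓝 0) := by
      have := tendsto_finsetSum (Finset.range m) fun k _ =>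
        ((hlim (basisVec k)).sub_const (a (basisVec k))).abs
      simpa using this
    exact this.eventually_lt_const hε
  filter_upwards [hsum, hnorm ε hε] with i hi hbi
  have hhead : ‖(b i - a).comp (truncationL m)‖ ≤ ε := by
    refine ContinuousLinearMap.opNorm_le_bound _ hε.le fun x => ?_
    rw [ContinuousLinearMap.comp_apply, truncationL_apply, truncation, map_sum]
    refine (norm_sum_le _ _).trans ?_
    refine (Finset.sum_le_sum (g := fun k => |b i (basisVec k) - a (basisVec k)| * ‖x‖)
      fun k _ => ?_).trans ?_
    · rw [map_smul, norm_smul, mul_comm]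
      exact mul_le_mul_of_nonneg_left (x.abs_apply_le_norm k) (abs_nonneg _)
    · rw [← Finset.sum_mul]
      exact mul_le_mul_of_nonneg_right hi.le (norm_nonneg _)
  have ha := norm_comp_truncationL_add_le m a
  have hb := norm_comp_truncationL_add_le m (b i)
  have hdiff : ‖a.comp (truncationL m)‖ ≤
      ‖(b i).comp (truncationL m)‖ + ‖(b i - a).comp (truncationL m)‖ := by
    have : a.comp (truncationL m) = (b i).comp (truncationL m) - (b i - a).comp (truncationL m) := by
      ext x; simp
    rw [this]
    exact norm_sub_le ((b i).comp (truncationL m)) ((b i - a).comp (truncationL m))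
  have hsplit : b i - a = (b i - a).comp (truncationL m) +
      ((b i).comp (ContinuousLinearMap.id ℝ _ - truncationL m) -
        a.comp (ContinuousLinearMap.id ℝ _ - truncationL m)) := by
    ext x
    simp only [ContinuousLinearMap.comp_apply, _root_.add_apply, _root_.sub_apply,
      ContinuousLinearMap.id_apply, map_sub]
    ring
  refine Metric.mem_ball.2 ((dist_eq_norm (b i) a).trans_lt ?_)
  rw [hsplit]
  have h1 := norm_add_le ((b i - a).comp (truncationL m))
    ((b i).comp (ContinuousLinearMap.id ℝ _ - truncationL m) -
        a.comp (ContinuousLinearMap.id ℝ _ - truncationL m))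
  have h2 := norm_sub_le ((b i).comp (ContinuousLinearMap.id ℝ _ - truncationL m))
    (a.comp (ContinuousLinearMap.id ℝ _ - truncationL m))
  linarith

end ZeroAtInftyContinuousMap

end NullSequences

namespace ZeroAtInftyContinuousMap

/-- The oscillation of a null sequence, as a bounded double sequence. -/
noncomputable def differences (x : C₀(ℕ, ℝ)) : BoundedContinuousFunction (ℕ × ℕ) ℝ :=
  x.toBCF.compContinuous ⟨Prod.fst, continuous_fst⟩ -
    x.toBCF.compContinuous ⟨Prod.snd, continuous_snd⟩

theorem differences_apply (x : C₀(ℕ, ℝ)) (n m : ℕ) : x.differences (n, m) = x n - x m := rfl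

/-- Half the oscillation of a null sequence, a norm on `c₀` equivalent to the supremum norm. -/
noncomputable def oscSeminorm : Seminorm ℝ C₀(ℕ, ℝ) :=
  Seminorm.of (fun x => ‖x.differences‖ / 2)
    (fun x y => by
      have : (x + y).differences = x.differences + y.differences := by
        ext ⟨n, m⟩
        simp only [differences_apply, BoundedContinuousFunction.add_apply, add_apply]
        ring
      rw [this, ← add_div]
      exact div_le_div_of_nonneg_right (norm_add_le _ _) zero_le_two)
    (fun c x => by
      have : (c • x).differences = c • x.differences := by
        ext ⟨n, m⟩
        simp only [differences_apply, BoundedContinuousFunction.smul_apply, smul_apply, smul_eq_mul]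
        ring
      rw [this, norm_smul, mul_div_assoc])

theorem oscSeminorm_le {x : C₀(ℕ, ℝ)} {C : ℝ} (hC : 0 ≤ C) (h : ∀ n m, |x n - x m| ≤ 2 * C) :
    oscSeminorm x ≤ C := by
  have : ‖x.differences‖ ≤ 2 * C :=
    (BoundedContinuousFunction.norm_le (by positivity)).2 fun ⟨n, m⟩ => h n m
  change ‖x.differences‖ / 2 ≤ C
  linarith

theorem abs_sub_le_oscSeminorm (x : C₀(ℕ, ℝ)) (n m : ℕ) : |x n - x m| ≤ 2 * oscSeminorm x := by
  have : |x n - x m| ≤ ‖x.differences‖ := x.differences.norm_coe_le_norm (n, m)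
  change |x n - x m| ≤ 2 * (‖x.differences‖ / 2)
  linarith

theorem abs_apply_le_oscSeminorm (x : C₀(ℕ, ℝ)) (n : ℕ) : |x n| ≤ 2 * oscSeminorm x := by
  have h : Tendsto (fun m => |x n - x m|) atTop (𝓝 |x n - 0|) :=
    (x.tendsto_apply_atTop.const_sub (x n)).abs
  rw [sub_zero] at h
  exact le_of_tendsto h (Eventually.of_forall fun m => x.abs_sub_le_oscSeminorm n m)

theorem oscSeminorm_le_norm (x : C₀(ℕ, ℝ)) : oscSeminorm x ≤ ‖x‖ := by
  refine oscSeminorm_le (norm_nonneg _) fun n m => ?_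
  have h1 := x.abs_apply_le_norm n
  have h2 := x.abs_apply_le_norm m
  have := abs_sub (x n) (x m)
  linarith

theorem norm_le_oscSeminorm (x : C₀(ℕ, ℝ)) : ‖x‖ ≤ 2 * oscSeminorm x :=
  norm_le_of_forall_abs_le (mul_nonneg zero_le_two (apply_nonneg _ _)) x.abs_apply_le_oscSeminorm

variable {Y : Type*} [NormedAddCommGroup Y] [NormedSpace ℝ Y] (e : C₀(ℕ, ℝ) ≃ₗ[ℝ] Y)

theorem abs_dual_apply_le (he : ∀ x, ‖e x‖ = oscSeminorm x) (g : StrongDual ℝ Y) (x : C₀(ℕ, ℝ)) :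
    |g (e x)| ≤ ‖g‖ * oscSeminorm x := by
  rw [← he]
  exact g.le_opNorm _

theorem sum_abs_dual_basisVec_le (he : ∀ x, ‖e x‖ = oscSeminorm x) (g : StrongDual ℝ Y) (m : ℕ) :
    ∑ k ∈ Finset.range m, |g (e (basisVec k))| ≤ ‖g‖ := by
  set y : ℕ → ℝ := fun k => SignType.sign (g (e (basisVec k)))
  have h1 : ∑ k ∈ Finset.range m, |g (e (basisVec k))| = g (e (truncation m y)) := by
    simp only [truncation, map_sum, map_smul, smul_eq_mul, y, sign_mul_self]
  have h2 : ‖truncation m y‖ ≤ 1 := by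
    refine norm_le_of_forall_abs_le zero_le_one fun n => ?_
    rw [truncation_apply]
    split_ifs
    · simp only [y]
      rcases SignType.sign (g (e (basisVec n))) with _ | _ | _ <;> simp
    · simp
  rw [h1]
  refine (le_abs_self _).trans ((abs_dual_apply_le e he g _).trans ?_)
  exact mul_le_of_le_one_right (norm_nonneg _) ((oscSeminorm_le_norm _).trans h2)

theorem summable_abs_dual_basisVec (he : ∀ x, ‖e x‖ = oscSeminorm x) (g : StrongDual ℝ Y) :
    Summable fun k => |g (e (basisVec k))| :=
  summable_of_sum_range_le (fun _ => abs_nonneg _) (sum_abs_dual_basisVec_le e he g)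

theorem abs_tsum_dual_basisVec_le (he : ∀ x, ‖e x‖ = oscSeminorm x) (g : StrongDual ℝ Y) :
    |∑' k, g (e (basisVec k))| ≤ ‖g‖ := by
  have h1 : |∑' k, g (e (basisVec k))| ≤ ∑' k, |g (e (basisVec k))| :=
    norm_tsum_le_tsum_norm (f := fun k => g (e (basisVec k))) (summable_abs_dual_basisVec e he g)
  refine h1.trans ?_
  exact Real.tsum_le_of_sum_range_le (fun _ => abs_nonneg _) (sum_abs_dual_basisVec_le e he g)

/-- The sum of the coefficients of a functional, as a linear form on the dual. -/
noncomputable def coeffSumLinear (he : ∀ x, ‖e x‖ = oscSeminorm x) : StrongDual ℝ Y →ₗ[ℝ] ℝ where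
  toFun g := ∑' k, g (e (basisVec k))
  map_add' g h := (summable_abs_dual_basisVec e he g).of_abs.tsum_add
    (summable_abs_dual_basisVec e he h).of_abs
  map_smul' c g := by simp only [_root_.smul_apply, smul_eq_mul, RingHom.id_apply, tsum_mul_left]

/-- The sum of the coefficients of a functional, as an element of the bidual. -/
noncomputable def coeffSum (he : ∀ x, ‖e x‖ = oscSeminorm x) : StrongDual ℝ (StrongDual ℝ Y) :=
  (coeffSumLinear e he).mkContinuous 1 fun g => by
    have h := abs_tsum_dual_basisVec_le e he g
    rw [← one_mul ‖g‖] at h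
    exact h

theorem hasSum_coeffSum (he : ∀ x, ‖e x‖ = oscSeminorm x) (g : StrongDual ℝ Y) :
    HasSum (fun k => g (e (basisVec k))) (coeffSum e he g) :=
  (summable_abs_dual_basisVec e he g).of_abs.hasSum

/-- Translating a null sequence to vanish at `n` does not change its oscillation; hence subtracting
the total mass of a functional at `n` does not increase its norm. -/
theorem abs_sub_coeffSum_mul_le (he : ∀ x, ‖e x‖ = oscSeminorm x) (g : StrongDual ℝ Y) (n : ℕ)
    (x : C₀(ℕ, ℝ)) : |g (e x) - coeffSum e he g * x n| ≤ ‖g‖ * oscSeminorm x := by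
  have h1 : Tendsto (fun m => ∑ k ∈ Finset.range m, x k * g (e (basisVec k))) atTop
      (𝓝 (g (e x))) := by
    have hc : Continuous fun x => g (e x) := by
      refine (LinearMap.mkContinuous (g.toLinearMap.comp e.toLinearMap) ‖g‖ fun x => ?_).continuous
      exact (abs_dual_apply_le e he g x).trans
        (mul_le_mul_of_nonneg_left x.oscSeminorm_le_norm (norm_nonneg _))
    have := (hc.tendsto x).comp x.tendsto_truncation
    refine this.congr fun m => ?_
    simp [truncation, map_sum]
  have h2 : Tendsto (fun m => (∑ k ∈ Finset.range m, g (e (basisVec k))) * x n) atTop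
      (𝓝 (coeffSum e he g * x n)) :=
    (hasSum_coeffSum e he g).tendsto_sum_nat.mul_const _
  refine le_of_tendsto (h1.sub h2).abs (Eventually.of_forall fun m => ?_)
  have h3 : ∑ k ∈ Finset.range m, x k * g (e (basisVec k)) -
      (∑ k ∈ Finset.range m, g (e (basisVec k))) * x n =
      g (e (truncation m fun k => x k - x n)) := by
    rw [Finset.sum_mul]
    simp only [truncation, map_sum, map_smul, smul_eq_mul, sub_mul, Finset.sum_sub_distrib, mul_comm]
  rw [h3]
  refine (abs_dual_apply_le e he g _).trans (mul_le_mul_of_nonneg_left ?_ (norm_nonneg _))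
  refine oscSeminorm_le (apply_nonneg _ _) fun i j => ?_
  simp only [truncation_apply]
  split_ifs
  · simpa using x.abs_sub_le_oscSeminorm i j
  · simpa using x.abs_sub_le_oscSeminorm i n
  · simpa [abs_sub_comm] using x.abs_sub_le_oscSeminorm j n
  · simp

/-- The `n`-th coordinate functional. -/
noncomputable def coordDual (he : ∀ x, ‖e x‖ = oscSeminorm x) (n : ℕ) : StrongDual ℝ Y :=
  LinearMap.mkContinuous
    { toFun := fun y => e.symm y n
      map_add' := fun y z => by simp
      map_smul' := fun c y => by simp } 2
    fun y => by
      refine ((e.symm y).abs_apply_le_oscSeminorm n).trans ?_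
      rw [← he, e.apply_symm_apply]

theorem coordDual_apply (he : ∀ x, ‖e x‖ = oscSeminorm x) (n : ℕ) (x : C₀(ℕ, ℝ)) :
    coordDual e he n (e x) = x n := by
  change e.symm (e x) n = x n
  rw [e.symm_apply_apply]

theorem coeffSum_coordDual (he : ∀ x, ‖e x‖ = oscSeminorm x) (n : ℕ) :
    coeffSum e he (coordDual e he n) = 1 := by
  refine (hasSum_coeffSum e he _).unique ?_
  simp only [coordDual_apply, basisVec_apply]
  simpa [eq_comm] using hasSum_ite_eq n (1 : ℝ)

theorem coeffSum_eq_zero_of_isNamiokaPoint (he : ∀ x, ‖e x‖ = oscSeminorm x) {g : StrongDual ℝ Y}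
    (hg : IsNamiokaPoint g) : coeffSum e he g = 0 := by
  have hg1 : ‖g‖ ≤ 1 := by simpa using hg.1
  have h := hg.tendsto (l := atTop) (u := fun n => g - coeffSum e he g • coordDual e he n) ?_ ?_
    (coeffSum e he)
  · have h0 : ∀ n, coeffSum e he (g - coeffSum e he g • coordDual e he n) = 0 := fun n => by
      rw [map_sub, map_smul, coeffSum_coordDual]
      simp
    simp only [h0] at h
    exact tendsto_nhds_unique h tendsto_const_nhds |>.symm ▸ rfl
  · intro n
    refine ContinuousLinearMap.opNorm_le_bound _ zero_le_one fun y => ?_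
    obtain ⟨x, rfl⟩ := e.surjective y
    rw [he]
    simp only [_root_.sub_apply, _root_.smul_apply, coordDual_apply, smul_eq_mul, Real.norm_eq_abs]
    exact (abs_sub_coeffSum_mul_le e he g n x).trans
      (mul_le_mul_of_nonneg_right hg1 (apply_nonneg _ _))
  · intro y
    obtain ⟨x, rfl⟩ := e.surjective y
    simp only [_root_.sub_apply, _root_.smul_apply, coordDual_apply, smul_eq_mul]
    simpa using (x.tendsto_apply_atTop.const_mul (coeffSum e he g)).const_sub (g (e x))

theorem not_propertyN_of_oscSeminorm (he : ∀ x, ‖e x‖ = oscSeminorm x) : ¬ PropertyN Y := by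
  intro hN
  set f := coordDual e he 0
  have hf : f ≠ 0 := by
    intro h
    have := coeffSum_coordDual e he 0
    rw [show coordDual e he 0 = 0 from h, map_zero] at this
    exact zero_ne_one this
  have hmem : toWeakSpace ℝ (StrongDual ℝ Y) (‖f‖⁻¹ • f) ∈
      closure (toWeakSpace ℝ (StrongDual ℝ Y) '' {g : StrongDual ℝ Y | IsNamiokaPoint g}) := by
    refine hN ⟨_, ?_, rfl⟩
    rw [mem_sphere_zero_iff_norm, norm_smul, norm_inv, norm_norm,
      inv_mul_cancel₀ (norm_ne_zero_iff.2 hf)]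
  have h := closure_toWeakSpace_subset_ker (coeffSum e he)
    (fun g hg => coeffSum_eq_zero_of_isNamiokaPoint e he hg) hmem
  rw [map_smul, coeffSum_coordDual, smul_eq_mul, mul_one] at h
  exact hf (norm_eq_zero.1 (inv_eq_zero.1 h))

end ZeroAtInftyContinuousMap

section Hilbert

variable {H : Type*} [NormedAddCommGroup H] [InnerProductSpace ℝ H]

theorem exists_bidual_eq_eval [CompleteSpace H] (φ : StrongDual ℝ (StrongDual ℝ H)) :
    ∃ h : H, ∀ w : StrongDual ℝ H, φ w = w h := by
  set T := (InnerProductSpace.toDual ℝ H)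
  set ψ : StrongDual ℝ H := φ.comp (innerSL ℝ)
  obtain ⟨h, hh⟩ := T.surjective ψ
  refine ⟨h, fun w => ?_⟩
  obtain ⟨y, rfl⟩ := T.surjective w
  have h1 : φ (T y) = T h y := by rw [hh]; rfl
  rw [h1, InnerProductSpace.toDual_apply_apply, InnerProductSpace.toDual_apply_apply,
    real_inner_comm]

theorem exists_norm_add_smul_eq {h v : H} (hv : ‖v‖ = 1) {r : ℝ} (hr : ‖h‖ ≤ r) :
    ∃ t : ℝ, ‖h + t • v‖ = r ∧ |t| ≤ 2 * r := by
  have hr0 : 0 ≤ r := (norm_nonneg h).trans hr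
  set c := inner ℝ h v
  have hc : |c| ≤ ‖h‖ := by simpa [hv] using abs_real_inner_le_norm h v
  have hsq : c ^ 2 ≤ ‖h‖ ^ 2 := sq_le_sq' (abs_le.1 hc).1 (abs_le.1 hc).2
  have hhr : ‖h‖ ^ 2 ≤ r ^ 2 := pow_le_pow_left₀ (norm_nonneg h) hr 2
  set d := √(c ^ 2 + (r ^ 2 - ‖h‖ ^ 2))
  have hd : d ^ 2 = c ^ 2 + (r ^ 2 - ‖h‖ ^ 2) :=
    Real.sq_sqrt (add_nonneg (sq_nonneg c) (sub_nonneg.2 hhr))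
  have hd0 : 0 ≤ d := Real.sqrt_nonneg _
  have hdr : d ≤ r := abs_le_of_sq_le_sq' (by linarith) hr0 |>.2
  refine ⟨d - c, ?_, ?_⟩
  · have h1 : ‖h + (d - c) • v‖ ^ 2 = r ^ 2 := by
      rw [norm_add_sq_real, inner_smul_right, norm_smul, hv, Real.norm_eq_abs, mul_one, sq_abs]
      change ‖h‖ ^ 2 + 2 * ((d - c) * c) + (d - c) ^ 2 = r ^ 2
      linear_combination hd
    exact (sq_eq_sq₀ (norm_nonneg _) hr0).1 h1
  · have := abs_sub d c
    rw [abs_of_nonneg hd0] at this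
    linarith

end Hilbert

section InfConvolution

variable {V : Type*} [NormedAddCommGroup V] [NormedSpace ℝ V]

/-- The inf-convolution of a seminorm with the norm: the largest seminorm below both. -/
noncomputable def Seminorm.infNorm (p : Seminorm ℝ V) : Seminorm ℝ V := p ⊓ normSeminorm ℝ V

theorem Seminorm.infNorm_le (p : Seminorm ℝ V) (u : V) : p.infNorm u ≤ p u :=
  (inf_le_left : p ⊓ normSeminorm ℝ V ≤ p) u

theorem Seminorm.infNorm_le_norm (p : Seminorm ℝ V) (u : V) : p.infNorm u ≤ ‖u‖ :=
  (inf_le_right : p ⊓ normSeminorm ℝ V ≤ normSeminorm ℝ V) u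

theorem Seminorm.le_infNorm {p q : Seminorm ℝ V} (h1 : ∀ u, q u ≤ p u) (h2 : ∀ u, q u ≤ ‖u‖)
    (u : V) : q u ≤ p.infNorm u :=
  (le_inf h1 h2 : q ≤ p ⊓ normSeminorm ℝ V) u

end InfConvolution

namespace ZeroAtInftyContinuousMap

/-- The inf-convolution of the maximum norm of `c₀ × ℓ²` with `(x, h) ↦ osc x / 2 + ‖h‖`: its unit
ball is generated by the two unit balls. -/
noncomputable def hullSeminorm : Seminorm ℝ (C₀(ℕ, ℝ) × lp (fun _ : ℕ => ℝ) 2) :=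
  (oscSeminorm.comp (LinearMap.fst ℝ C₀(ℕ, ℝ) (lp (fun _ : ℕ => ℝ) 2)) +
    (normSeminorm ℝ (lp (fun _ : ℕ => ℝ) 2)).comp
      (LinearMap.snd ℝ C₀(ℕ, ℝ) (lp (fun _ : ℕ => ℝ) 2))).infNorm

theorem hullSeminorm_le_norm (u : C₀(ℕ, ℝ) × lp (fun _ : ℕ => ℝ) 2) : hullSeminorm u ≤ ‖u‖ :=
  Seminorm.infNorm_le_norm _ u

theorem hullSeminorm_le_osc_add (u : C₀(ℕ, ℝ) × lp (fun _ : ℕ => ℝ) 2) :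
    hullSeminorm u ≤ oscSeminorm u.1 + ‖u.2‖ :=
  Seminorm.infNorm_le _ u

theorem le_hullSeminorm {q : Seminorm ℝ (C₀(ℕ, ℝ) × lp (fun _ : ℕ => ℝ) 2)}
    (h1 : ∀ u, q u ≤ oscSeminorm u.1 + ‖u.2‖) (h2 : ∀ u, q u ≤ ‖u‖)
    (u : C₀(ℕ, ℝ) × lp (fun _ : ℕ => ℝ) 2) : q u ≤ hullSeminorm u :=
  Seminorm.le_infNorm h1 h2 u

theorem norm_le_two_mul_hullSeminorm (u : C₀(ℕ, ℝ) × lp (fun _ : ℕ => ℝ) 2) :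
    ‖u‖ ≤ 2 * hullSeminorm u := by
  have h := le_hullSeminorm (q := (2⁻¹ : NNReal) • normSeminorm ℝ _) ?_ ?_ u
  · have h' : (2 : ℝ)⁻¹ * ‖u‖ ≤ hullSeminorm u := h
    linarith
  · intro u
    change (2 : ℝ)⁻¹ * ‖u‖ ≤ _
    have h1 := u.1.norm_le_oscSeminorm
    have h2 := norm_nonneg u.2
    have h3 : 0 ≤ oscSeminorm u.1 := apply_nonneg _ _
    have : ‖u‖ ≤ 2 * (oscSeminorm u.1 + ‖u.2‖) := by
      rw [Prod.norm_def]
      exact max_le (by linarith) (by linarith)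
    linarith
  · intro u
    change (2 : ℝ)⁻¹ * ‖u‖ ≤ _
    have := norm_nonneg u
    linarith

theorem hullSeminorm_inl (x : C₀(ℕ, ℝ)) : hullSeminorm (x, 0) = oscSeminorm x := by
  refine le_antisymm ((hullSeminorm_le_osc_add _).trans (by simp)) ?_
  exact le_hullSeminorm
    (q := oscSeminorm.comp (LinearMap.fst ℝ C₀(ℕ, ℝ) (lp (fun _ : ℕ => ℝ) 2)))
    (fun u => le_add_of_nonneg_right (norm_nonneg _))
    (fun u => (oscSeminorm_le_norm _).trans (norm_fst_le u)) (x, 0)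

variable {X : Type*} [NormedAddCommGroup X] [NormedSpace ℝ X]
  (E : (C₀(ℕ, ℝ) × lp (fun _ : ℕ => ℝ) 2) ≃L[ℝ] X)

/-- The `c₀`-component of a functional. -/
noncomputable def dualFst (f : StrongDual ℝ X) : StrongDual ℝ C₀(ℕ, ℝ) :=
  (f.comp (E : (C₀(ℕ, ℝ) × lp (fun _ : ℕ => ℝ) 2) →L[ℝ] X)).comp (ContinuousLinearMap.inl ℝ _ _)

/-- The `ℓ²`-component of a functional. -/
noncomputable def dualSnd (f : StrongDual ℝ X) : StrongDual ℝ (lp (fun _ : ℕ => ℝ) 2) :=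
  (f.comp (E : (C₀(ℕ, ℝ) × lp (fun _ : ℕ => ℝ) 2) →L[ℝ] X)).comp (ContinuousLinearMap.inr ℝ _ _)

theorem dualFst_apply (f : StrongDual ℝ X) (x : C₀(ℕ, ℝ)) : dualFst E f x = f (E (x, 0)) := rfl

theorem dualSnd_apply (f : StrongDual ℝ X) (h : lp (fun _ : ℕ => ℝ) 2) :
    dualSnd E f h = f (E (0, h)) := rfl

/-- Extend functionals on `c₀` to the renormed product. -/
noncomputable def extendFst : StrongDual ℝ C₀(ℕ, ℝ) →L[ℝ] StrongDual ℝ X :=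
  ContinuousLinearMap.precomp ℝ
    ((ContinuousLinearMap.fst ℝ _ _).comp (E.symm : X →L[ℝ] C₀(ℕ, ℝ) × lp (fun _ : ℕ => ℝ) 2))

/-- Extend functionals on `ℓ²` to the renormed product. -/
noncomputable def extendSnd : StrongDual ℝ (lp (fun _ : ℕ => ℝ) 2) →L[ℝ] StrongDual ℝ X :=
  ContinuousLinearMap.precomp ℝ
    ((ContinuousLinearMap.snd ℝ _ _).comp (E.symm : X →L[ℝ] C₀(ℕ, ℝ) × lp (fun _ : ℕ => ℝ) 2))

theorem extendFst_apply (a : StrongDual ℝ C₀(ℕ, ℝ)) (u : C₀(ℕ, ℝ) × lp (fun _ : ℕ => ℝ) 2) :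
    extendFst E a (E u) = a u.1 := by
  change a (E.symm (E u)).1 = _
  rw [E.symm_apply_apply]

theorem extendSnd_apply (z : StrongDual ℝ (lp (fun _ : ℕ => ℝ) 2))
    (u : C₀(ℕ, ℝ) × lp (fun _ : ℕ => ℝ) 2) : extendSnd E z (E u) = z u.2 := by
  change z (E.symm (E u)).2 = _
  rw [E.symm_apply_apply]

theorem extendFst_add_extendSnd (f : StrongDual ℝ X) :
    extendFst E (dualFst E f) + extendSnd E (dualSnd E f) = f := by
  ext y
  obtain ⟨u, rfl⟩ := E.surjective y
  rw [_root_.add_apply, extendFst_apply, extendSnd_apply, dualFst_apply, dualSnd_apply,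
    ← map_add, ← map_add]
  simp

theorem norm_dual_le_one (hE : ∀ u, ‖E u‖ = hullSeminorm u) {f : StrongDual ℝ X}
    (h1 : ∀ u, |f (E u)| ≤ oscSeminorm u.1 + ‖u.2‖) (h2 : ∀ u, |f (E u)| ≤ ‖u‖) : ‖f‖ ≤ 1 := by
  refine f.opNorm_le_bound zero_le_one fun y => ?_
  obtain ⟨u, rfl⟩ := E.surjective y
  rw [one_mul, hE]
  exact le_hullSeminorm
    (q := (normSeminorm ℝ ℝ).comp (f.toLinearMap.comp E.toLinearEquiv.toLinearMap)) h1 h2 u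

theorem abs_dual_apply_le_hullSeminorm (hE : ∀ u, ‖E u‖ = hullSeminorm u) {f : StrongDual ℝ X}
    (hf : ‖f‖ ≤ 1) (u : C₀(ℕ, ℝ) × lp (fun _ : ℕ => ℝ) 2) : |f (E u)| ≤ hullSeminorm u := by
  rw [← hE]
  simpa using f.le_of_opNorm_le hf (E u)

theorem norm_dualFst_add_norm_dualSnd_le (hE : ∀ u, ‖E u‖ = hullSeminorm u) {f : StrongDual ℝ X}
    (hf : ‖f‖ ≤ 1) : ‖dualFst E f‖ + ‖dualSnd E f‖ ≤ 1 := by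
  refine (norm_comp_inl_add_norm_comp_inr_le _).trans ?_
  refine ContinuousLinearMap.opNorm_le_bound _ zero_le_one fun u => ?_
  rw [one_mul]
  exact (abs_dual_apply_le_hullSeminorm E hE hf u).trans (hullSeminorm_le_norm u)

theorem isNamiokaPoint_of_norm_add_norm_eq_one (hE : ∀ u, ‖E u‖ = hullSeminorm u)
    {f : StrongDual ℝ X} (hf : ‖f‖ ≤ 1) (hsum : ‖dualFst E f‖ + ‖dualSnd E f‖ = 1) :
    IsNamiokaPoint f := by
  refine isNamiokaPoint_of_tendsto hf fun l hl hlim φ => ?_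
  have hsnd : ∀ h, Tendsto (fun g => dualSnd E g h) l (𝓝 (dualSnd E f h)) := fun h => hlim _
  have hfst : Tendsto (dualFst E) l (𝓝 (dualFst E f)) := by
    refine tendsto_dual_of_tendsto_apply (fun x => hlim _) fun ε hε => ?_
    filter_upwards [hl, eventually_lt_norm_of_tendsto_apply hsnd
      (sub_lt_self ‖dualSnd E f‖ hε)] with g hg hg2
    have := norm_dualFst_add_norm_dualSnd_le E hE hg
    linarith
  obtain ⟨k, hk⟩ := exists_bidual_eq_eval (φ.comp (extendSnd E))
  have hφ : ∀ g, φ g = φ (extendFst E (dualFst E g)) + dualSnd E g k := fun g => by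
    conv_lhs => rw [← extendFst_add_extendSnd E g]
    rw [map_add, ← hk]
    rfl
  rw [hφ f]
  refine Tendsto.congr (fun g => (hφ g).symm) (Tendsto.add ?_ (hsnd k))
  exact ((φ.comp (extendFst E)).continuous.tendsto _).comp hfst

theorem tendsto_lp_apply (k : lp (fun _ : ℕ => ℝ) 2) : Tendsto (fun n => k n) atTop (𝓝 0) := by
  have h := ((lp.memℓp k).summable (by norm_num)).tendsto_atTop_zero
  have h2 := (h.rpow_const (p := 2⁻¹) (Or.inr (by norm_num)))
  rw [Real.zero_rpow (by norm_num)] at h2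
  refine tendsto_zero_iff_norm_tendsto_zero.2 (h2.congr fun n => ?_)
  rw [← Real.rpow_mul (norm_nonneg _)]
  norm_num

theorem propertyN_of_hullSeminorm (hE : ∀ u, ‖E u‖ = hullSeminorm u) : PropertyN X := by
  rintro _ ⟨f, hf, rfl⟩
  have hf1 : ‖f‖ ≤ 1 := (mem_sphere_zero_iff_norm.1 hf).le
  set T := InnerProductSpace.toDual ℝ (lp (fun _ : ℕ => ℝ) 2)
  set a := dualFst E f
  obtain ⟨h, hh⟩ := T.surjective (dualSnd E f)
  set v : ℕ → lp (fun _ : ℕ => ℝ) 2 := fun n => lp.single 2 n (1 : ℝ)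
  have hv : ∀ n, ‖v n‖ = 1 := fun n => by simp [v, lp.norm_single]
  have hnorm : ‖a‖ + ‖h‖ ≤ 1 := by
    have := norm_dualFst_add_norm_dualSnd_le E hE hf1
    rwa [← hh, LinearIsometryEquiv.norm_map] at this
  choose t ht using fun n => exists_norm_add_smul_eq (hv n) (le_sub_iff_add_le'.2 hnorm)
  set g : ℕ → StrongDual ℝ X := fun n => extendFst E a + extendSnd E (T (h + t n • v n))
  have hg : ∀ n u, g n (E u) = a u.1 + T (h + t n • v n) u.2 := fun n u => by
    simp only [g, _root_.add_apply, extendFst_apply, extendSnd_apply]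
  have hTn : ∀ n, ‖T (h + t n • v n)‖ = 1 - ‖a‖ := fun n => by
    rw [LinearIsometryEquiv.norm_map, (ht n).1]
  have ha0 := norm_nonneg a
  have ha1 : ‖a‖ ≤ 1 := le_trans (le_add_of_nonneg_right (norm_nonneg h)) hnorm
  have hball : ∀ n, ‖g n‖ ≤ 1 := fun n => by
    have hT : ∀ k, |T (h + t n • v n) k| ≤ (1 - ‖a‖) * ‖k‖ := fun k => by
      rw [← hTn n]
      exact (T (h + t n • v n)).le_opNorm k
    refine norm_dual_le_one E hE (fun u => ?_) (fun u => ?_)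
    · have h1 : |a u.1| ≤ oscSeminorm u.1 := by
        rw [← hullSeminorm_inl]
        exact abs_dual_apply_le_hullSeminorm E hE hf1 (u.1, 0)
      have h2 : (1 - ‖a‖) * ‖u.2‖ ≤ ‖u.2‖ := mul_le_of_le_one_left (norm_nonneg _) (by linarith)
      rw [hg]
      exact (abs_add_le _ _).trans (add_le_add h1 ((hT u.2).trans h2))
    · have h1 : |a u.1| ≤ ‖a‖ * ‖u‖ :=
        (a.le_opNorm u.1).trans (mul_le_mul_of_nonneg_left (norm_fst_le u) ha0)
      have h2 : (1 - ‖a‖) * ‖u.2‖ ≤ (1 - ‖a‖) * ‖u‖ :=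
        mul_le_mul_of_nonneg_left (norm_snd_le u) (by linarith)
      rw [hg]
      refine (abs_add_le _ _).trans ((add_le_add h1 ((hT u.2).trans h2)).trans_eq ?_)
      ring
  have hNam : ∀ n, IsNamiokaPoint (g n) := fun n => by
    refine isNamiokaPoint_of_norm_add_norm_eq_one E hE (hball n) ?_
    have h1 : dualFst E (g n) = a := by
      ext x
      rw [dualFst_apply, hg]
      simp
    have h2 : dualSnd E (g n) = T (h + t n • v n) := by
      ext1 k
      rw [dualSnd_apply, hg]
      simp
    rw [h1, h2, hTn]
    ring
  refine mem_closure_of_tendsto (f := fun n => toWeakSpace ℝ (StrongDual ℝ X) (g n)) (b := atTop)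
    (tendsto_toWeakSpace_iff.2 fun φ => ?_) (Eventually.of_forall fun n => ⟨g n, hNam n, rfl⟩)
  obtain ⟨k, hk⟩ := exists_bidual_eq_eval (φ.comp (extendSnd E))
  have hφ : ∀ n, φ (g n) = φ f + t n * k n := fun n => by
    have h1 : g n = f + t n • extendSnd E (T (v n)) := by
      rw [← extendFst_add_extendSnd E f, ← hh]
      simp only [g, map_add, map_smul, add_assoc]
      rfl
    have h2 : φ (extendSnd E (T (v n))) = k n := by
      rw [show φ (extendSnd E (T (v n))) = T (v n) k from hk _,
        InnerProductSpace.toDual_apply_apply, lp.inner_single_left]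
      simp
    rw [h1, map_add, map_smul, h2, smul_eq_mul]
  have hlim : Tendsto (fun n => t n * k n) atTop (𝓝 0) := by
    refine squeeze_zero_norm (a := fun n => 2 * (1 - ‖a‖) * |k n|) (fun n => ?_) ?_
    · rw [norm_mul]
      exact mul_le_mul_of_nonneg_right (ht n).2 (abs_nonneg _)
    · simpa using (tendsto_lp_apply k).abs.const_mul (2 * (1 - ‖a‖))
  simp only [hφ]
  simpa using hlim.const_add (φ f)

/-- The space `c₀ × ℓ²` with the norm `hullSeminorm`. -/
def RenormedProd : Type := C₀(ℕ, ℝ) × lp (fun _ : ℕ => ℝ) 2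

noncomputable instance : AddCommGroup RenormedProd :=
  inferInstanceAs (AddCommGroup (C₀(ℕ, ℝ) × lp (fun _ : ℕ => ℝ) 2))

noncomputable instance : Module ℝ RenormedProd :=
  inferInstanceAs (Module ℝ (C₀(ℕ, ℝ) × lp (fun _ : ℕ => ℝ) 2))

noncomputable instance : Norm RenormedProd := ⟨hullSeminorm⟩

theorem renormedProd_core : NormedSpace.Core ℝ RenormedProd where
  norm_nonneg := apply_nonneg hullSeminorm
  norm_smul := map_smul_eq_mul hullSeminorm
  norm_triangle := map_add_le_add hullSeminorm
  norm_eq_zero_iff u := by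
    refine ⟨fun h => ?_, fun h => h ▸ map_zero hullSeminorm⟩
    have h1 := norm_le_two_mul_hullSeminorm u
    rw [show hullSeminorm u = 0 from h, mul_zero] at h1
    exact norm_le_zero_iff.1 h1

noncomputable instance : NormedAddCommGroup RenormedProd :=
  NormedAddCommGroup.ofCore renormedProd_core

noncomputable instance : NormedSpace ℝ RenormedProd := NormedSpace.ofCore renormedProd_core

/-- The identity between the two norms on `c₀ × ℓ²`, as a linear map. -/
noncomputable def renormedProdLinearEquiv :
    (C₀(ℕ, ℝ) × lp (fun _ : ℕ => ℝ) 2) ≃ₗ[ℝ] RenormedProd :=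
  LinearEquiv.refl ℝ (C₀(ℕ, ℝ) × lp (fun _ : ℕ => ℝ) 2)

/-- The identity between the two norms on `c₀ × ℓ²`. -/
noncomputable def renormedProdEquiv : (C₀(ℕ, ℝ) × lp (fun _ : ℕ => ℝ) 2) ≃L[ℝ] RenormedProd :=
  renormedProdLinearEquiv.toContinuousLinearEquivOfBounds 1 2
    (fun u => (hullSeminorm_le_norm u).trans_eq (one_mul _).symm) norm_le_two_mul_hullSeminorm

theorem norm_renormedProdEquiv (u : C₀(ℕ, ℝ) × lp (fun _ : ℕ => ℝ) 2) :
    ‖renormedProdEquiv u‖ = hullSeminorm u := rfl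

instance : CompleteSpace RenormedProd :=
  (completeSpace_congr (e := renormedProdEquiv.toEquiv) renormedProdEquiv.isUniformEmbedding).1
    inferInstance

end ZeroAtInftyContinuousMap

open ZeroAtInftyContinuousMap in
theorem proposition5p1 :
    ∃ (X : Type) (_ : NormedAddCommGroup X) (_ : NormedSpace ℝ X) (_ : CompleteSpace X)
      (Y : Submodule ℝ X), IsClosed (Y : Set X) ∧ PropertyN X ∧ ¬ PropertyN Y := by
  set j : C₀(ℕ, ℝ) →ₗ[ℝ] RenormedProd :=
    renormedProdEquiv.toLinearEquiv.toLinearMap.comp (LinearMap.inl ℝ _ _)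
  have hj : Function.Injective j := renormedProdEquiv.injective.comp LinearMap.inl_injective
  refine ⟨RenormedProd, inferInstance, inferInstance, inferInstance, LinearMap.range j, ?_,
    propertyN_of_hullSeminorm renormedProdEquiv norm_renormedProdEquiv,
    not_propertyN_of_oscSeminorm (LinearEquiv.ofInjective j hj) fun x => hullSeminorm_inl x⟩
  have hY : (LinearMap.range j : Set RenormedProd) = {y | (renormedProdEquiv.symm y).2 = 0} := by
    ext y
    obtain ⟨u, rfl⟩ := renormedProdEquiv.surjective y
    simp only [Set.mem_ofPred_eq, renormedProdEquiv.symm_apply_apply]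
    constructor
    · rintro ⟨x, hx⟩
      rw [← renormedProdEquiv.injective hx]
      rfl
    · intro h
      exact ⟨u.1, congrArg renormedProdEquiv (Prod.ext rfl h.symm)⟩
  rw [hY]
  exact isClosed_eq (continuous_snd.comp renormedProdEquiv.symm.continuous) continuous_const
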